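/- Let $m\equiv 1 \pmod 4$ be a prime and let $p$ be an odd prime with $\left(\frac{m}{p}\right)=1$. Call integers $A,B,C$ an admissible triple if $A^2=m(B^2+C^2)$ and $A,B,C$ are pairwise coprime. For a quadratic residue $a$ modulo $m$, prime to $m$, let $\left(\frac{a}{m}\right)_4=1$ if $a$ is a fourth power modulo $m$, and $\left(\frac{a}{m}\right)_4=-1$ otherwise. Let $\left(\frac{A+B\sqrt m}{p}\right)$ be the Legendre symbol $\left(\frac{A+Br}{p}\right)$, where $r$ is an integer with $r^2\equiv m \pmod p$ and $p\nmid A+Br$. Put $p^*=(-1)^{(p-1)/2}p$. (i) For every admissible triple such an $r$ exists, and the symbol $\left(\frac{A+B\sqrt m}{p}\right)$ does not depend on the choice of $r$. (ii) For every admissible triple with $A,B,C>0$, $B$ odd and $C$ even, $$\left(\frac{A+B\sqrt m}{p}\right)=(-1)^{(p-1)(m-1)/8}\left(\frac{2}{p}\right)\left(\frac{p}{m}\right)_4 .$$ (iii) For every admissible triple with $A,B>0$ and $B$ even, $$\left(\frac{A+B\sqrt m}{p}\right)=(-1)^{(p-1)(m-1)/8}\left(\frac{p}{m}\right)_4=\left(\frac{p^*}{m}\right)_4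 .$$ (iv) For every admissible triple, $2(A+B\sqrt m)(A+C\sqrt m)=(A+B\sqrt m+C\sqrt m)^2$ and $\left(\frac{A+B\sqrt m}{p}\right)=\left(\frac{2}{p}\right)\left(\frac{A+C\sqrt m}{p}\right)$. (v) For every admissible triple with $B$ even and $A+B\equiv 1\pmod 4$, $$\left(\frac{A+B\sqrt m}{p}\right)=(-1)^{(p-1)(m-1)/8}\left(\frac{|A|+|B|\sqrt m}{p}\right),$$ and the following four formulas are equivalent: (a) $\left(\frac{A+B\sqrt m}{p}\right)=\left(\frac{p}{m}\right)_4$; (b) $\left(\frac{|A|+|C|\sqrt m}{p}\right)=(-1)^{(p-1)(m-1)/8}\left(\frac{2}{p}\right)\left(\frac{p}{m}\right)_4$; (c) $\left(\frac{|A|+|B|\sqrt m}{p}\right)=(-1)^{(p-1)(m-1)/8}\left(\frac{p}{m}\right)_4$; (d) $\left(\frac{|A|+|B|\sqrt m}{p}\right)=\left(\frac{p^*}{m}\right)_4$. -/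

import Mathlib

/-- Integers `A, B, C` with `A² = m (B² + C²)` that are pairwise coprime. -/
def IsQuarticTriple (m : ℕ) (A B C : ℤ) : Prop :=
  A ^ 2 = (m : ℤ) * (B ^ 2 + C ^ 2) ∧ IsCoprime A B ∧ IsCoprime B C ∧ IsCoprime C A

open Classical in
/-- The rational quartic residue symbol `(a/m)₄`, for quadratic residues `a` modulo a prime
`m ≡ 1 mod 4`: it is `1` if `a` is a fourth power modulo `m` and `-1` if it is not.
(The value is `0` if `a` is divisible by `m` or a quadratic nonresidue.) -/
noncomputable def ratQuarticSymbol (a : ℤ) (m : ℕ) : ℤ :=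
  if (a : ZMod m) = 0 then 0
  else if ∃ x : ZMod m, x ^ 4 = (a : ZMod m) then 1
  else if ∃ x : ZMod m, x ^ 2 = (a : ZMod m) then -1
  else 0

open Classical in
/-- The quadratic symbol `((A + B√m)/p)` for an odd prime `p` with `(m/p) = 1`: the Legendre symbol
modulo `p` of `A + B r`, where `r` is a square root of `m` modulo `p` (that is, a choice of a prime
above `p` in `ℚ(√m)`) for which `A + B r` is not `0` modulo `p`.
(The value is `0` if there is no such `r`.) -/
noncomputable def surdSymbol (m : ℕ) (A B : ℤ) (p : ℕ) [Fact p.Prime] : ℤ :=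
  if h : ∃ r : ZMod p, r ^ 2 = (m : ZMod p) ∧ (A : ZMod p) + (B : ZMod p) * r ≠ 0 then
    quadraticChar (ZMod p) ((A : ZMod p) + (B : ZMod p) * h.choose)
  else 0

/-- `p* = (-1)^((p-1)/2) p`. -/
def primeStar (p : ℕ) : ℤ := (-1) ^ ((p - 1) / 2) * (p : ℤ)

/-! The proof computes a quartic Gauss period in characteristic p. Let χ be a quartic character
modulo m with values in ℤ[i]. Its Jacobi sum J = J(χ,χ) = a + bi has norm m, with a odd and b even.
Over an algebraic closure of 𝔽_p, choose the additive character so that g(χ²) is a prescribed root r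
∈ 𝔽_p of r² = m, and put θ = g(χ) + g(χ³). The relations g(χ)² = rJ, g(χ³)² = rJ̄ and g(χ)g(χ³) =
χ(-1)m give θ² = 2(χ(-1)m + ar), an element of 𝔽_p.

Quadratic reciprocity makes p a square modulo m, so χ(p) = (p/m)₄ = ±1, and Frobenius acts by θ^p =
χ(p)θ (`quarticPeriod_pow_char`). By Euler's criterion θ², when nonzero, has quadratic symbol (p/m)₄
(`quadraticChar_quarticPeriod_sq`). The identity in (iv) exchanges 2(χ(-1)m + a√m) for χ(-1)m + b√m.
Removing χ(-1) = (-1)^((m-1)/4) costs a power of (-1/p), which is the sign in the formulas. This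
settles the triple (m, b, a).

Unique factorisation in ℤ[i] carries this to every triple with A > 0 and B even: B + Ci is a prime
of norm m times a square, up to sign, and (A + B√m)(m + b√m) is then a square
(`surdSymbol_eq_of_even`). The case of C even follows from (iv), and (v) from congruences modulo 4
and 8 that determine the sign of A. -/

namespace IsQuarticTriple

/-! ### Symmetries of admissible triples -/

variable {m : ℕ} {A B C : ℤ}

theorem swap (h : IsQuarticTriple m A B C) : IsQuarticTriple m A C B :=
  ⟨by rw [h.1, add_comm], h.2.2.2.symm, h.2.2.1.symm, h.2.1.symm⟩

theorem neg_left (h : IsQuarticTriple m A B C) : IsQuarticTriple m (-A) B C :=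
  ⟨by rw [neg_sq, h.1], h.2.1.neg_left, h.2.2.1, h.2.2.2.neg_right⟩

theorem neg_mid (h : IsQuarticTriple m A B C) : IsQuarticTriple m A (-B) C :=
  ⟨by rw [neg_sq, h.1], h.2.1.neg_right, h.2.2.1.neg_left, h.2.2.2⟩

theorem abs_left (h : IsQuarticTriple m A B C) : IsQuarticTriple m |A| B C := by
  rcases abs_choice A with e | e <;> rw [e]
  exacts [h, h.neg_left]

theorem abs_mid (h : IsQuarticTriple m A B C) : IsQuarticTriple m A |B| C := by
  rcases abs_choice B with e | e <;> rw [e]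
  exacts [h, h.neg_mid]

theorem odd_of_even (h : IsQuarticTriple m A B C) (hB : Even B) : Odd A := by
  rw [← Int.not_even_iff_odd]
  intro hA
  have := h.2.1.isUnit_of_dvd' hA.two_dvd hB.two_dvd
  exact absurd this (by decide)

theorem left_ne_zero [hm : Fact m.Prime] (h : IsQuarticTriple m A B C) : A ≠ 0 := by
  rintro rfl
  have hB : IsUnit B := isCoprime_zero_left.1 h.2.1
  have h1 := h.1
  have h2 : (0 : ℤ) < m := by exact_mod_cast hm.out.pos
  have h3 : B ^ 2 = 1 := by rcases Int.isUnit_iff.1 hB with rfl | rfl <;> rfl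
  nlinarith [sq_nonneg C, mul_nonneg h2.le (sq_nonneg C)]

theorem cast_zmod (h : IsQuarticTriple m A B C) (p : ℕ) :
    (A : ZMod p) ^ 2 = m * ((B : ZMod p) ^ 2 + (C : ZMod p) ^ 2) := by
  exact_mod_cast congrArg (Int.cast : ℤ → ZMod p) h.1

theorem not_both_zero (h : IsQuarticTriple m A B C) {p : ℕ} [Fact p.Prime]
    (hA : (A : ZMod p) = 0) : (B : ZMod p) ≠ 0 := by
  intro hB
  obtain ⟨u, v, huv⟩ := h.2.1
  have := congrArg (Int.cast : ℤ → ZMod p) huv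
  push_cast at this
  rw [hA, hB] at this
  simp at this

end IsQuarticTriple

/-! ### The quadratic symbol of A + B√m -/

section Surd

variable {m p : ℕ} [Fact p.Prime] {A B C : ℤ}

theorem ringChar_zmod_ne_two (hp : p ≠ 2) : ringChar (ZMod p) ≠ 2 := by
  rwa [ZMod.ringChar_zmod_n]

theorem two_ne_zero_zmod (hp : p ≠ 2) : (2 : ZMod p) ≠ 0 :=
  Ring.two_ne_zero (ringChar_zmod_ne_two hp)

theorem quadraticChar_eq_of_mul_eq_sq {F : Type*} [Field F] [Fintype F] [DecidableEq F]
    {x y z : F} (hx : x ≠ 0) (hy : y ≠ 0) (h : x * y = z ^ 2) :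
    quadraticChar F x = quadraticChar F y := by
  have hz : z ≠ 0 := by
    rintro rfl
    exact mul_ne_zero hx hy (by simpa using h)
  have h1 : quadraticChar F x * quadraticChar F y = 1 := by
    rw [← map_mul, h, quadraticChar_sq_one' hz]
  rcases quadraticChar_dichotomy hx with e | e <;>
  rcases quadraticChar_dichotomy hy with e' | e' <;> rw [e, e'] at h1 ⊢ <;> simp at h1

/-- The symbol does not depend on the choice of the square root. -/
theorem quadraticChar_eq_surdSymbol (h : IsQuarticTriple m A B C)
    {r : ZMod p} (hr : r ^ 2 = m) (h0 : (A : ZMod p) + B * r ≠ 0) :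
    quadraticChar (ZMod p) (A + B * r) = surdSymbol m A B p := by
  have hex : ∃ r : ZMod p, r ^ 2 = (m : ZMod p) ∧ (A : ZMod p) + (B : ZMod p) * r ≠ 0 :=
    ⟨r, hr, h0⟩
  rw [surdSymbol, dif_pos hex]
  obtain ⟨hs, hs0⟩ := hex.choose_spec
  generalize hex.choose = s at hs hs0 ⊢
  rcases sq_eq_sq_iff_eq_or_eq_neg.1 (hr.trans hs.symm) with rfl | rfl
  · rfl
  -- The two conjugates multiply to A² - mB² = mC² = (sC)².
  · refine quadraticChar_eq_of_mul_eq_sq (z := s * C) h0 hs0 ?_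
    linear_combination h.cast_zmod p + (-(B : ZMod p) ^ 2 - (C : ZMod p) ^ 2) * hs

/-- If both conjugates vanished, their sum and difference would make p divide both A and B, against
coprimality. -/
theorem exists_surd_ne_zero (h : IsQuarticTriple m A B C) (hp : p ≠ 2)
    (hm : (m : ZMod p) ≠ 0) {r : ZMod p} (hr : r ^ 2 = m) :
    (A : ZMod p) + B * r ≠ 0 ∨ (A : ZMod p) + B * (-r) ≠ 0 := by
  by_contra! hcon
  obtain ⟨h1, h2⟩ := hcon
  have hr0 : r ≠ 0 := by
    rintro rfl
    exact hm (by simpa using hr.symm)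
  have hA : (A : ZMod p) = 0 :=
    (mul_eq_zero.1 (show (2 : ZMod p) * A = 0 by linear_combination h1 + h2)).resolve_left
      (two_ne_zero_zmod hp)
  refine h.not_both_zero hA ?_
  exact (mul_eq_zero.1 (show (B : ZMod p) * r = 0 by linear_combination h1 - hA)).resolve_right hr0

theorem exists_quadraticChar_eq_surdSymbol (h : IsQuarticTriple m A B C) (hp : p ≠ 2)
    (hm : (m : ZMod p) ≠ 0) (hsq : IsSquare (m : ZMod p)) :
    ∃ r : ZMod p, r ^ 2 = m ∧ (A : ZMod p) + B * r ≠ 0 ∧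
      quadraticChar (ZMod p) (A + B * r) = surdSymbol m A B p := by
  obtain ⟨r, hr⟩ := hsq
  have hr : r ^ 2 = (m : ZMod p) := by rw [hr, sq]
  rcases exists_surd_ne_zero h hp hm hr with h0 | h0
  · exact ⟨r, hr, h0, quadraticChar_eq_surdSymbol h hr h0⟩
  · exact ⟨-r, by rw [neg_sq, hr], h0,
      quadraticChar_eq_surdSymbol h (by rw [neg_sq, hr]) h0⟩

theorem surdSymbol_neg_mid (h : IsQuarticTriple m A B C) (hp : p ≠ 2)
    (hm : (m : ZMod p) ≠ 0) (hsq : IsSquare (m : ZMod p)) :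
    surdSymbol m A (-B) p = surdSymbol m A B p := by
  obtain ⟨r, hr, h0, e⟩ := exists_quadraticChar_eq_surdSymbol h hp hm hsq
  have hx : (A : ZMod p) + ((-B : ℤ) : ZMod p) * (-r) = A + B * r := by push_cast; ring
  rw [← e, ← quadraticChar_eq_surdSymbol h.neg_mid (r := -r) (by rw [neg_sq, hr])
    (by rwa [hx]), hx]

theorem surdSymbol_abs_mid (h : IsQuarticTriple m A B C) (hp : p ≠ 2)
    (hm : (m : ZMod p) ≠ 0) (hsq : IsSquare (m : ZMod p)) :
    surdSymbol m A |B| p = surdSymbol m A B p := by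
  rcases abs_choice B with e | e <;> rw [e]
  exact surdSymbol_neg_mid h hp hm hsq

theorem surdSymbol_neg_left (h : IsQuarticTriple m A B C) (hp : p ≠ 2)
    (hm : (m : ZMod p) ≠ 0) (hsq : IsSquare (m : ZMod p)) :
    surdSymbol m (-A) B p = quadraticChar (ZMod p) (-1) * surdSymbol m A B p := by
  obtain ⟨r, hr, h0, e⟩ := exists_quadraticChar_eq_surdSymbol h hp hm hsq
  have hx : ((-A : ℤ) : ZMod p) + (B : ZMod p) * (-r) = (-1) * (A + B * r) := by push_cast; ring
  rw [← e, ← quadraticChar_eq_surdSymbol h.neg_left (r := -r) (by rw [neg_sq, hr])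
    (by rw [hx]; exact mul_ne_zero (by simp) h0), hx, map_mul]

/-- The relation `2 (A + B√m) (A + C√m) = (A + B√m + C√m)²` between the two symbols. -/
theorem surdSymbol_eq_two_mul_swap (h : IsQuarticTriple m A B C) (hp : p ≠ 2)
    (hm : (m : ZMod p) ≠ 0) (hsq : IsSquare (m : ZMod p)) :
    surdSymbol m A B p = quadraticChar (ZMod p) 2 * surdSymbol m A C p := by
  obtain ⟨r, hr, h0, e⟩ := exists_quadraticChar_eq_surdSymbol h hp hm hsq
  have h2 := two_ne_zero_zmod hp
  have hc := h.cast_zmod p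
  rw [← e]
  by_cases h1 : (A : ZMod p) + C * r = 0
  -- Here r is unusable for the second symbol. But then p divides B, so the first symbol is that of
  -- A, and the conjugate root gives 2A for the second.
  · have hC : (A : ZMod p) + C * (-r) = 2 * A := by linear_combination -h1
    have hB : (B : ZMod p) = 0 := by
      have : (m : ZMod p) * (B : ZMod p) ^ 2 = 0 := by
        linear_combination -hc + (A - C * r) * h1 + (C : ZMod p) ^ 2 * hr
      simpa [hm] using this
    have hA : (A : ZMod p) ≠ 0 := by simpa [hB] using h0
    rw [← quadraticChar_eq_surdSymbol h.swap (r := -r) (by rw [neg_sq, hr])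
      (by rw [hC]; exact mul_ne_zero h2 hA), hC, ← map_mul, hB, zero_mul, add_zero]
    exact quadraticChar_eq_of_mul_eq_sq (z := 2 * A) hA (by simp [h2, hA]) (by ring)
  · rw [← quadraticChar_eq_surdSymbol h.swap hr h1, ← map_mul]
    refine quadraticChar_eq_of_mul_eq_sq (z := A + B * r + C * r) h0 (mul_ne_zero h2 h1) ?_
    linear_combination hc - ((B : ZMod p) ^ 2 + (C : ZMod p) ^ 2) * hr

end Surd

/-! ### Factorisation in ℤ[i] and reduction to one triple -/

/-- The ideal (z, z̄) contains 2 Re z and 2 Im z, hence 2, and also the odd number z z̄, hence 1. -/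
theorem GaussianInt.isCoprime_star_of_odd_norm {z : GaussianInt} (h : IsCoprime z.re z.im)
    (hodd : Odd z.norm) : IsCoprime z (star z) := by
  obtain ⟨u, v, huv⟩ := h
  obtain ⟨k, hk⟩ := hodd
  have h1 : z.norm = z.re * z.re + z.im * z.im := by rw [Zsqrtd.norm_def]; ring
  rw [h1] at hk
  refine ⟨star z - k * (u + v * ⟨0, -1⟩), -(k * (u - v * ⟨0, -1⟩) : GaussianInt), ?_⟩
  ext
  · simp
    linear_combination hk - 2 * k * huv
  · simp
    ring

/-- The prime π divides w w̄, so π or its conjugate divides w. The cofactor z has norm k² and is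
coprime to z̄, so unique factorisation makes it a unit times a square. -/
theorem GaussianInt.exists_eq_mul_sq {π w : GaussianInt} {m k : ℤ} (hm : Prime m)
    (hπ : π.norm = m) (hw : IsCoprime w.re w.im) (hk : Odd k) (hn : w.norm = m * k ^ 2) :
    ∃ π' u d : GaussianInt, π'.re = π.re ∧ (π'.im = π.im ∨ π'.im = -π.im) ∧ u.norm = 1 ∧
      d.norm ^ 2 = k ^ 2 ∧ w = π' * d ^ 2 * u := by
  have hprime : Prime π := by
    refine Irreducible.prime ⟨fun hu => ?_, fun a b hab => ?_⟩
    · exact hm.not_isUnit (hπ ▸ (Zsqrtd.isUnit_iff_norm_isUnit π).1 hu)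
    · rw [Zsqrtd.isUnit_iff_norm_isUnit, Zsqrtd.isUnit_iff_norm_isUnit]
      exact hm.irreducible.isUnit_or_isUnit (by rw [← hπ, hab, Zsqrtd.norm_mul])
  have hdvd : π ∣ w * star w := by
    rw [← Zsqrtd.norm_eq_mul_conj, hn, ← hπ]
    push_cast
    rw [Zsqrtd.norm_eq_mul_conj, mul_assoc]
    exact dvd_mul_right _ _
  obtain ⟨π', hre, him, hnorm, z, hz⟩ : ∃ π' : GaussianInt, π'.re = π.re ∧
      (π'.im = π.im ∨ π'.im = -π.im) ∧ π'.norm = m ∧ π' ∣ w := by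
    rcases hprime.dvd_or_dvd hdvd with h | ⟨c, hc⟩
    · exact ⟨π, rfl, Or.inl rfl, hπ, h⟩
    · refine ⟨star π, rfl, Or.inr rfl, by rw [Zsqrtd.norm_conj, hπ], star c, ?_⟩
      rw [← star_star w, hc, star_mul, mul_comm]
  have hzn : z.norm = k ^ 2 := by
    rw [hz, Zsqrtd.norm_mul, hnorm] at hn
    exact mul_left_cancel₀ hm.ne_zero hn
  have hcop : IsCoprime z (star z) := by
    refine GaussianInt.isCoprime_star_of_odd_norm
      (Zsqrtd.isCoprime_of_dvd_isCoprime hw ⟨π', by rw [hz, mul_comm]⟩) ?_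
    rw [hzn]
    exact hk.pow
  obtain ⟨d, u, hu⟩ := exists_associated_pow_of_mul_eq_pow' hcop (c := (k : GaussianInt)) (k := 2)
    (by rw [← Zsqrtd.norm_eq_mul_conj, hzn]; push_cast; rfl)
  have hun : (u : GaussianInt).norm = 1 := (Zsqrtd.norm_eq_one_iff' (by norm_num) _).2 u.isUnit
  refine ⟨π', u, d, hre, him, hun, ?_, by rw [hz, ← hu, mul_assoc]⟩
  rw [← hzn, ← hu, Zsqrtd.norm_mul, hun, sq d, Zsqrtd.norm_mul]
  ring

/-- Triples with `A > 0` and `B` even, parametrised through a Gaussian integer `b + a i` of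
norm `m` with `b` even. -/
theorem IsQuarticTriple.exists_param {m : ℕ} [hm : Fact m.Prime] {A B C a b : ℤ}
    (h : IsQuarticTriple m A B C) (hA : 0 < A) (hB : Even B) (hab : b ^ 2 + a ^ 2 = m)
    (ha : Odd a) (hb : Even b) :
    ∃ a' x y : ℤ, a' ^ 2 = a ^ 2 ∧ A = m * (x ^ 2 + y ^ 2) ∧
      B = b * (x ^ 2 - y ^ 2) - 2 * a' * x * y := by
  have hmp : Prime (m : ℤ) := Nat.prime_iff_prime_int.1 hm.out
  obtain ⟨k, rfl⟩ : (m : ℤ) ∣ A := hmp.dvd_of_dvd_pow (n := 2) ⟨_, h.1⟩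
  have hm0 : (0 : ℤ) < m := by exact_mod_cast hm.out.pos
  have hk0 : 0 < k := pos_of_mul_pos_right hA hm0.le
  have hk : Odd k := (Int.odd_mul.1 (h.odd_of_even hB)).2
  have hn : B ^ 2 + C ^ 2 = m * k ^ 2 := by
    apply mul_left_cancel₀ hmp.ne_zero
    linear_combination -h.1
  obtain ⟨π', u, d, hre, him, hu, hd, hw⟩ := GaussianInt.exists_eq_mul_sq (π := ⟨b, a⟩)
    (w := ⟨B, C⟩) hmp (by rw [Zsqrtd.norm_def]; linear_combination hab) h.2.2.1 hk
    (by rw [Zsqrtd.norm_def]; linear_combination hn)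
  obtain ⟨c, a'⟩ := π'
  obtain ⟨x, y⟩ := d
  obtain ⟨s, t⟩ := u
  simp only at hre him
  subst hre
  have ha2 : a' ^ 2 = a ^ 2 := by rcases him with rfl | rfl <;> ring
  have ha' : Odd a' := by rcases him with rfl | rfl; exacts [ha, ha.neg]
  have hdk : x ^ 2 + y ^ 2 = k := by
    have h1 : (⟨x, y⟩ : GaussianInt).norm = x ^ 2 + y ^ 2 := by rw [Zsqrtd.norm_def]; ring
    rw [h1] at hd
    exact (pow_left_inj₀ (by positivity) hk0.le two_ne_zero).1 hd
  have hst : s ^ 2 + t ^ 2 = 1 := by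
    rw [Zsqrtd.norm_def] at hu
    linear_combination hu
  have hBe : B = (c * (x ^ 2 - y ^ 2) - 2 * a' * x * y) * s -
      (c * (2 * x * y) + a' * (x ^ 2 - y ^ 2)) * t := by
    have := congrArg Zsqrtd.re hw
    simp [sq] at this
    linear_combination this
  have hs1 : s ^ 2 ≤ 1 := by nlinarith [sq_nonneg t]
  have hs : s = -1 ∨ s = 0 ∨ s = 1 := by
    have := abs_le.1 ((sq_le_one_iff_abs_le_one s).1 hs1)
    omega
  have hxy : Odd (x ^ 2 - y ^ 2) := by
    have e : x ^ 2 - y ^ 2 = k - 2 * y ^ 2 := by linear_combination hdk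
    rw [e]
    exact hk.sub_even (even_two_mul _)
  rcases hs with rfl | rfl | rfl
  -- The unit -1 = i² is absorbed into the square: x + yi becomes i(x + yi) = -y + xi.
  · have ht : t = 0 := by nlinarith
    subst ht
    exact ⟨a', -y, x, ha2, by rw [← hdk]; ring, by rw [hBe]; ring⟩
  -- A unit ±i would make B, up to sign, the imaginary part of π'd², which is odd.
  · exfalso
    have ht : t = 1 ∨ t = -1 := sq_eq_one_iff.1 (by linarith)
    have hodd : Odd (c * (2 * x * y) + a' * (x ^ 2 - y ^ 2)) :=
      (hb.mul_right _).add_odd (ha'.mul hxy)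
    rw [← Int.not_even_iff_odd] at hodd
    apply hodd
    rcases ht with rfl | rfl
    · have : c * (2 * x * y) + a' * (x ^ 2 - y ^ 2) = -B := by rw [hBe]; ring
      rw [this]; exact hB.neg
    · have : c * (2 * x * y) + a' * (x ^ 2 - y ^ 2) = B := by rw [hBe]; ring
      rw [this]; exact hB
  · have ht : t = 0 := by nlinarith
    subst ht
    exact ⟨a', x, y, ha2, by rw [← hdk], by rw [hBe]; ring⟩

/-- The symbols of all triples with `A > 0` and `B` even agree. -/
theorem surdSymbol_eq_of_even {m p : ℕ} [Fact m.Prime] [Fact p.Prime] {A B C a b : ℤ}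
    (h : IsQuarticTriple m A B C) (hA : 0 < A) (hB : Even B) (hab : b ^ 2 + a ^ 2 = m)
    (ha : Odd a) (hb : Even b) (h' : IsQuarticTriple m m b a) (hp : p ≠ 2)
    (hm : (m : ZMod p) ≠ 0) (hsq : IsSquare (m : ZMod p)) :
    surdSymbol m A B p = surdSymbol m m b p := by
  obtain ⟨a', x, y, ha', hAe, hBe⟩ := h.exists_param hA hB hab ha hb
  obtain ⟨r, hr, h0, e⟩ := exists_quadraticChar_eq_surdSymbol h hp hm hsq
  have hab' : (b : ZMod p) ^ 2 + (a' : ZMod p) ^ 2 = m := by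
    rw [← ha'] at hab
    exact_mod_cast congrArg (Int.cast : ℤ → ZMod p) hab
  have hA' : (A : ZMod p) = m * (x ^ 2 + y ^ 2) := by rw [hAe]; push_cast; rfl
  have hB' : (B : ZMod p) = b * (x ^ 2 - y ^ 2) - 2 * a' * x * y := by rw [hBe]; push_cast; rfl
  rw [← e]
  by_cases h1 : ((m : ℤ) : ZMod p) + b * r = 0
  -- In this degenerate case p divides a', and A + Br is y² times the conjugate m - br.
  · have h2 : ((m : ℤ) : ZMod p) + b * (-r) ≠ 0 :=
      (exists_surd_ne_zero h' hp hm hr).resolve_left (fun h => h h1)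
    rw [← quadraticChar_eq_surdSymbol h' (r := -r) (by rw [neg_sq, hr]) h2]
    have ha0 : (a' : ZMod p) = 0 := by
      push_cast at h1
      have : (m : ZMod p) * (a' : ZMod p) ^ 2 = 0 := by
        linear_combination (m - b * r) * h1 + m * hab' + b ^ 2 * hr
      simpa [hm] using this
    have e2 : (A : ZMod p) + B * r = y ^ 2 * (((m : ℤ) : ZMod p) + b * (-r)) := by
      rw [hA', hB', ha0]
      push_cast at h1 ⊢
      linear_combination x ^ 2 * h1
    refine quadraticChar_eq_of_mul_eq_sq (z := y * (((m : ℤ) : ZMod p) + b * (-r))) h0 h2 ?_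
    rw [e2]
    ring
  · rw [← quadraticChar_eq_surdSymbol h' hr h1]
    -- Since r² = m = b² + a'², the product (A + Br)(m + br) is the square of x(m + br) - ya'r.
    refine quadraticChar_eq_of_mul_eq_sq
      (z := x * (((m : ℤ) : ZMod p) + b * r) - y * a' * r) h0 h1 ?_
    rw [hA', hB']
    push_cast
    linear_combination -y ^ 2 * m * hab' - y ^ 2 * (b ^ 2 + a' ^ 2) * hr

/-! ### Quartic characters and their Jacobi sums -/

theorem MulChar.inv_eq_pow_three {R M : Type*} [CommMonoid R] [CommRing M]
    {φ : MulChar R M} (hφ : orderOf φ = 4) : φ⁻¹ = φ ^ 3 := by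
  apply inv_eq_of_mul_eq_one_right
  rw [← pow_succ', show 3 + 1 = orderOf φ from hφ.symm, pow_orderOf_eq_one]

theorem MulChar.pow_ne_one_of_orderOf_four {R M : Type*} [CommMonoid R] [CommRing M]
    {φ : MulChar R M} (hφ : orderOf φ = 4) : φ ≠ 1 ∧ φ ^ 2 ≠ 1 := by
  constructor
  · rintro rfl
    simp at hφ
  · intro h
    have := orderOf_dvd_of_pow_eq_one h
    rw [hφ] at this
    norm_num at this

section QuarticChar

variable {m : ℕ} [Fact m.Prime]

theorem isPrimitiveRoot_gaussianInt_i : IsPrimitiveRoot (⟨0, 1⟩ : GaussianInt) 4 := by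
  have := IsPrimitiveRoot.orderOf (⟨0, 1⟩ : GaussianInt)
  rwa [show orderOf (⟨0, 1⟩ : GaussianInt) = 4 from
    orderOf_eq_prime_pow (p := 2) (n := 1) (by decide) (by decide)] at this

theorem exists_quartic_mulChar (hm : m % 4 = 1) :
    ∃ χ : MulChar (ZMod m) GaussianInt, orderOf χ = 4 := by
  refine MulChar.exists_mulChar_orderOf (ZMod m) ?_ isPrimitiveRoot_gaussianInt_i
  rw [ZMod.card]
  omega

variable {χ : MulChar (ZMod m) GaussianInt}

theorem MulChar.apply_pow_four (hχ : orderOf χ = 4) {x : ZMod m} (hx : x ≠ 0) : χ x ^ 4 = 1 := by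
  rw [← MulChar.pow_apply' χ (by norm_num), ← hχ, pow_orderOf_eq_one,
    MulChar.one_apply (isUnit_iff_ne_zero.2 hx)]

theorem MulChar.exists_generator_sq_eq_neg_one (hχ : orderOf χ = 4) :
    ∃ g : (ZMod m)ˣ, (∀ v : (ZMod m)ˣ, ∃ k : ℕ, g ^ k = v) ∧ χ g ^ 2 = -1 := by
  obtain ⟨g, hg⟩ := IsCyclic.exists_monoid_generator (α := (ZMod m)ˣ)
  refine ⟨g, hg, ?_⟩
  have h4 : (χ g ^ 2) ^ 2 = 1 := by
    rw [← pow_mul]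
    exact MulChar.apply_pow_four hχ g.ne_zero
  refine (sq_eq_one_iff.1 h4).resolve_left fun h => ?_
  have h2 : χ ^ 2 = 1 := by
    rw [MulChar.eq_one_iff]
    intro a
    obtain ⟨k, rfl⟩ := hg a
    rw [MulChar.pow_apply' χ two_ne_zero, Units.val_pow_eq_pow_val, map_pow, ← pow_mul, mul_comm,
      pow_mul, h, one_pow]
  have := orderOf_dvd_of_pow_eq_one h2
  rw [hχ] at this
  norm_num at this

/-- For a generator g, -1 = g^((m-1)/2) and χ(g)² = -1. -/
theorem MulChar.apply_neg_one_of_orderOf_four (hm : m % 4 = 1) (hχ : orderOf χ = 4) :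
    χ (-1) = (-1) ^ ((m - 1) / 4) := by
  obtain ⟨g, hg, hg2⟩ := MulChar.exists_generator_sq_eq_neg_one hχ
  have hord : orderOf g = m - 1 := by
    rw [orderOf_eq_card_of_forall_mem_zpowers fun v => ?_, Nat.card_eq_fintype_card,
      ZMod.card_units]
    obtain ⟨k, rfl⟩ := hg v
    exact Subgroup.npow_mem_zpowers g k
  have hm1 : 1 < m := (Fact.out : m.Prime).one_lt
  have h1 : ((g : ZMod m) ^ (2 * ((m - 1) / 4))) ^ 2 = 1 := by
    rw [← pow_mul, show 2 * ((m - 1) / 4) * 2 = orderOf g by omega, ← Units.val_pow_eq_pow_val,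
      pow_orderOf_eq_one, Units.val_one]
  have h2 : (g : ZMod m) ^ (2 * ((m - 1) / 4)) ≠ 1 := by
    intro h
    have h' : g ^ (2 * ((m - 1) / 4)) = 1 := Units.ext (by rw [Units.val_pow_eq_pow_val, h]; rfl)
    have := Nat.le_of_dvd (by omega) (orderOf_dvd_of_pow_eq_one h')
    omega
  rw [← (sq_eq_one_iff.1 h1).resolve_left h2, map_pow, pow_mul, hg2]

theorem MulChar.exists_pow_four_of_apply_eq_one (hχ : orderOf χ = 4) {a : ZMod m} (ha : χ a = 1) :
    ∃ x : ZMod m, x ^ 4 = a := by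
  obtain ⟨g, hg, hg2⟩ := MulChar.exists_generator_sq_eq_neg_one hχ
  have hu : IsUnit a := by
    by_contra h
    rw [MulChar.map_nonunit χ h] at ha
    exact zero_ne_one ha
  obtain ⟨k, hk⟩ := hg hu.unit
  have hk' : (g : ZMod m) ^ k = a := by rw [← Units.val_pow_eq_pow_val, hk, IsUnit.unit_spec]
  have hord : orderOf (χ g) = 4 := by
    refine orderOf_eq_prime_pow (p := 2) (n := 1) ?_ ?_
    · rw [pow_one, hg2]
      decide
    · exact MulChar.apply_pow_four hχ g.ne_zero
  obtain ⟨l, rfl⟩ : 4 ∣ k := by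
    rw [← hord]
    apply orderOf_dvd_of_pow_eq_one
    rw [← map_pow, hk', ha]
  exact ⟨(g : ZMod m) ^ l, by rw [← hk', ← pow_mul, mul_comm]⟩

/-- On nonzero squares χ takes only the values ±1, and its kernel consists of the fourth powers. -/
theorem ratQuarticSymbol_eq_mulChar (hχ : orderOf χ = 4) {a : ℤ} (ha : (a : ZMod m) ≠ 0)
    (hsq : IsSquare (a : ZMod m)) : (ratQuarticSymbol a m : GaussianInt) = χ a := by
  obtain ⟨y, hy⟩ := hsq
  have hy0 : y ≠ 0 := by
    rintro rfl
    exact ha (by simpa using hy)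
  have h1 : χ a = 1 ∨ χ a = -1 := by
    apply sq_eq_one_iff.1
    rw [hy, ← sq, map_pow, ← pow_mul]
    exact MulChar.apply_pow_four hχ hy0
  rw [ratQuarticSymbol, if_neg ha]
  split_ifs with h4 h2
  · obtain ⟨x, hx⟩ := h4
    rw [← hx, map_pow, MulChar.apply_pow_four hχ]
    · simp
    · rintro rfl
      exact ha (by simpa using hx.symm)
  · rw [h1.resolve_left fun h => h4 (MulChar.exists_pow_four_of_apply_eq_one hχ h)]
    simp
  · exact absurd ⟨y, by rw [hy, sq]⟩ h2

theorem ratQuarticSymbol_eq_or (a : ℤ) (ha : (a : ZMod m) ≠ 0) (hsq : IsSquare (a : ZMod m)) :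
    ratQuarticSymbol a m = 1 ∨ ratQuarticSymbol a m = -1 := by
  obtain ⟨y, hy⟩ := hsq
  rw [ratQuarticSymbol, if_neg ha]
  split_ifs with h4 h2
  · exact Or.inl rfl
  · exact Or.inr rfl
  · exact absurd ⟨y, by rw [hy, sq]⟩ h2

theorem MulChar.pow_three_apply_eq_star (hχ : orderOf χ = 4) (x : ZMod m) :
    (χ ^ 3) x = star (χ x) := by
  rw [MulChar.pow_apply' χ (by norm_num)]
  rcases eq_or_ne x 0 with rfl | hx
  · simp
  have h4 := MulChar.apply_pow_four hχ hx
  have hu : IsUnit (χ x) := IsUnit.of_pow_eq_one h4 (by norm_num)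
  have hn := (Zsqrtd.norm_eq_one_iff' (by norm_num) _).2 hu
  have h1 : χ x * star (χ x) = 1 := by rw [← Zsqrtd.norm_eq_mul_conj, hn]; rfl
  apply hu.mul_left_cancel
  rw [h1, ← pow_succ', h4]

theorem jacobiSum_pow_three (hχ : orderOf χ = 4) :
    jacobiSum (χ ^ 3) (χ ^ 3) = star (jacobiSum χ χ) := by
  simp only [jacobiSum, star_sum, star_mul', MulChar.pow_three_apply_eq_star hχ]

theorem MulChar.orderOf_ringHomComp (hχ : orderOf χ = 4) {F : Type*} [Field F]
    (h2 : (2 : F) ≠ 0) (f : GaussianInt →+* F) : orderOf (χ.ringHomComp f) = 4 := by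
  refine orderOf_eq_prime_pow (p := 2) (n := 1) ?_ ?_
  · obtain ⟨g, -, hg⟩ := MulChar.exists_generator_sq_eq_neg_one hχ
    intro h
    have h1 := congrArg (fun φ : MulChar (ZMod m) F => φ g) h
    simp only [pow_one] at h1
    rw [MulChar.pow_apply' _ two_ne_zero, MulChar.ringHomComp_apply, ← map_pow, hg,
      MulChar.one_apply g.isUnit, map_neg, map_one] at h1
    exact h2 (by linear_combination -h1)
  · rw [MulChar.ringHomComp_pow, show 2 ^ (1 + 1) = orderOf χ by rw [hχ]; rfl, pow_orderOf_eq_one]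
    ext a
    simp

/-- After embedding ℤ[i] in ℂ this is J(χ,χ)J(χ⁻¹,χ⁻¹) = m, because χ⁻¹ = χ³ is the conjugate of χ.
-/
theorem norm_jacobiSum (hχ : orderOf χ = 4) : (jacobiSum χ χ).norm = m := by
  have hφ := MulChar.orderOf_ringHomComp hχ (F := ℂ) two_ne_zero GaussianInt.toComplex
  obtain ⟨h1, h2⟩ := MulChar.pow_ne_one_of_orderOf_four hφ
  have hm0 := (Fact.out : m.Prime).ne_zero
  have := jacobiSum_mul_jacobiSum_inv (by
    rw [ZMod.ringChar_zmod_n, ringChar.eq_zero]; exact hm0.symm) h1 h1 (by rwa [← sq])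
  rw [MulChar.inv_eq_pow_three hφ, MulChar.ringHomComp_pow, jacobiSum_ringHomComp,
    jacobiSum_ringHomComp, jacobiSum_pow_three hχ, ← map_mul, ← Zsqrtd.norm_eq_mul_conj,
    map_intCast, ZMod.card] at this
  exact_mod_cast this

theorem odd_re_jacobiSum (hm : m % 4 = 1) (hχ : orderOf χ = 4) :
    Odd (jacobiSum χ χ).re ∧ Even (jacobiSum χ χ).im := by
  have h4 : χ ^ 4 = 1 := by rw [← hχ, pow_orderOf_eq_one]
  -- J(χ,χ) ≡ -1 modulo (i - 1)² = -2i, which fixes both parities.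
  obtain ⟨z, -, hz⟩ := exists_jacobiSum_eq_neg_one_add (n := 4) (by norm_num) h4 h4
    (by rw [ZMod.card]; omega) isPrimitiveRoot_gaussianInt_i
  rw [hz]
  have h2 : ((⟨0, 1⟩ : GaussianInt) - 1) ^ 2 = ⟨0, -2⟩ := by decide
  rw [h2]
  constructor
  · refine ⟨z.im - 1, ?_⟩
    simp
    ring
  · refine ⟨-z.re, ?_⟩
    simp
    ring

end QuarticChar

/-! ### Quartic Gauss sums in characteristic p -/

section QuarticPeriod

variable {m : ℕ} [Fact m.Prime] {χ : MulChar (ZMod m) GaussianInt} {F : Type*} [Field F]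

theorem gaussSum_sq_eq_of_orderOf_four (hχ : orderOf χ = 4) (h2 : (2 : F) ≠ 0) (hm : (m : F) ≠ 0)
    (f : GaussianInt →+* F) {ψ : AddChar (ZMod m) F} (hψ : ψ.IsPrimitive) :
    gaussSum (χ.ringHomComp f) ψ ^ 2 =
        gaussSum (χ.ringHomComp f ^ 2) ψ * f (jacobiSum χ χ) ∧
      gaussSum (χ.ringHomComp f ^ 3) ψ ^ 2 =
        gaussSum (χ.ringHomComp f ^ 2) ψ * f (star (jacobiSum χ χ)) ∧
      gaussSum (χ.ringHomComp f) ψ * gaussSum (χ.ringHomComp f ^ 3) ψ = f (χ (-1)) * m ∧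
      gaussSum (χ.ringHomComp f ^ 2) ψ ^ 2 = m := by
  have hφ := MulChar.orderOf_ringHomComp hχ h2 f
  have hJ : jacobiSum (χ.ringHomComp f) (χ.ringHomComp f) = f (jacobiSum χ χ) :=
    jacobiSum_ringHomComp χ χ f
  have hJ3 : jacobiSum (χ.ringHomComp f ^ 3) (χ.ringHomComp f ^ 3) = f (star (jacobiSum χ χ)) := by
    rw [MulChar.ringHomComp_pow, jacobiSum_ringHomComp, jacobiSum_pow_three hχ]
  have hneg : χ.ringHomComp f (-1) = f (χ (-1)) := rfl
  generalize χ.ringHomComp f = φ at *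
  obtain ⟨n1, n2⟩ := MulChar.pow_ne_one_of_orderOf_four hφ
  have h6 : φ ^ 3 * φ ^ 3 = φ ^ 2 := by
    rw [← pow_add, show 3 + 3 = orderOf φ + 2 by rw [hφ], pow_add, pow_orderOf_eq_one, one_mul]
  have e1 : gaussSum φ ψ ^ 2 = gaussSum (φ ^ 2) ψ * f (jacobiSum χ χ) := by
    have := jacobiSum_mul_nontrivial (χ := φ) (φ := φ) (by rwa [← sq]) ψ
    rw [← sq, ← sq, hJ] at this
    exact this.symm
  have e2 : gaussSum (φ ^ 3) ψ ^ 2 = gaussSum (φ ^ 2) ψ * f (star (jacobiSum χ χ)) := by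
    have := jacobiSum_mul_nontrivial (χ := φ ^ 3) (φ := φ ^ 3) (by rwa [h6]) ψ
    rw [h6, ← sq, hJ3] at this
    exact this.symm
  have e3 : gaussSum φ ψ * gaussSum (φ ^ 3) ψ = f (χ (-1)) * m := by
    have := gaussSum_mul_gaussSum_pow_orderOf_sub_one n1 hψ
    rwa [hφ, ZMod.card, hneg] at this
  refine ⟨e1, e2, e3, ?_⟩
  have hN : f (jacobiSum χ χ) * f (star (jacobiSum χ χ)) = m := by
    rw [← map_mul, ← Zsqrtd.norm_eq_mul_conj, norm_jacobiSum hχ]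
    simp
  have hs : f (χ (-1)) ^ 2 = 1 := by
    rw [← map_pow, ← map_pow, neg_one_sq, map_one, map_one]
  -- The value of g(χ²)² comes from computing (g(χ)g(χ³))² in two ways: as g(χ²)² J J̄ and as m².
  apply mul_right_cancel₀ hm
  calc gaussSum (φ ^ 2) ψ ^ 2 * m = gaussSum φ ψ ^ 2 * gaussSum (φ ^ 3) ψ ^ 2 := by
        rw [e1, e2, ← hN]; ring
    _ = (m : F) * m := by rw [← mul_pow, e3, mul_pow, hs]; ring

/-- Twisting ψ by a generator g multiplies the quadratic Gauss sum by χ²(g) = -1, so either square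
root of m can be attained. -/
theorem exists_primitive_gaussSum_eq (hχ : orderOf χ = 4) (h2 : (2 : F) ≠ 0) (hm : (m : F) ≠ 0)
    (f : GaussianInt →+* F) {ψ : AddChar (ZMod m) F} (hψ : ψ.IsPrimitive) {r : F}
    (hr : r ^ 2 = m) :
    ∃ ψ' : AddChar (ZMod m) F, ψ'.IsPrimitive ∧ gaussSum (χ.ringHomComp f ^ 2) ψ' = r := by
  have hR := (gaussSum_sq_eq_of_orderOf_four hχ h2 hm f hψ).2.2.2
  rcases sq_eq_sq_iff_eq_or_eq_neg.1 (hR.trans hr.symm) with h | h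
  · exact ⟨ψ, hψ, h⟩
  obtain ⟨g, -, hg⟩ := MulChar.exists_generator_sq_eq_neg_one hχ
  refine ⟨ψ.mulShift g, AddChar.IsPrimitive.of_ne_one (hψ g.ne_zero), ?_⟩
  have h1 := gaussSum_mulShift (χ.ringHomComp f ^ 2) ψ g
  rw [h, MulChar.pow_apply' _ two_ne_zero, MulChar.ringHomComp_apply, ← map_pow, hg, map_neg,
    map_one] at h1
  linear_combination -h1

/-- The action of Frobenius on the quartic period `g(χ) + g(χ³)`. -/
theorem quarticPeriod_pow_char {p : ℕ} [Fact p.Prime] [CharP F p] {φ : MulChar (ZMod m) F}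
    (hφ : orderOf φ = 4) (hp : p ≠ 2) (hpm : (p : ZMod m) ≠ 0) {e : F} (he : φ p = e)
    (he2 : e ^ 2 = 1) (ψ : AddChar (ZMod m) F) :
    (gaussSum φ ψ + gaussSum (φ ^ 3) ψ) ^ p = e * (gaussSum φ ψ + gaussSum (φ ^ 3) ψ) := by
  have hodd := (Fact.out : p.Prime).eq_two_or_odd.resolve_left hp
  have he4 : ∀ n k : ℕ, e ^ (2 * n + k) = e ^ k := fun n k => by
    rw [pow_add, pow_mul, he2, one_pow, one_mul]
  have h4 : ∀ n k : ℕ, φ ^ (4 * n + k) = φ ^ k := fun n k => by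
    rw [pow_add, pow_mul, ← hφ, pow_orderOf_eq_one, one_pow, one_mul]
  -- Frobenius replaces φ^k by φ^(kp) and ψ by its shift by p. Undoing the shift costs φ(p)^(kp) =
  -- e, since e = ±1 and kp is odd.
  have key : ∀ k : ℕ, Odd k → gaussSum (φ ^ k) ψ ^ p = e * gaussSum (φ ^ (k * p)) ψ := by
    rintro k ⟨l, rfl⟩
    have h1 := gaussSum_mulShift (φ ^ ((2 * l + 1) * p)) ψ (Units.mk0 (p : ZMod m) hpm)
    have hkp : (2 * l + 1) * p = 2 * (2 * l * (p / 2) + l + p / 2) + 1 := by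
      have : p = 2 * (p / 2) + 1 := by omega
      conv_lhs => rw [this]
      ring
    rw [Units.val_mk0, MulChar.pow_apply' _ (by rw [hkp]; omega), he, hkp, he4, ← hkp,
      pow_one] at h1
    rw [gaussSum_frob, AddChar.pow_mulShift, ← pow_mul, ← h1, ← mul_assoc, ← sq, he2, one_mul]
  have k1 := key 1 odd_one
  have k3 := key 3 (by decide)
  rw [pow_one, one_mul] at k1
  rw [add_pow_char, k1, k3, ← mul_add]
  congr 1
  -- Raising to the p-th power fixes φ and φ³ or exchanges them; the sum is the same either way.
  rcases (by omega : p % 4 = 1 ∨ p % 4 = 3) with h | h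
  · rw [show p = 4 * (p / 4) + 1 by omega, h4,
      show 3 * (4 * (p / 4) + 1) = 4 * (3 * (p / 4)) + 3 by ring, h4, pow_one]
  · rw [show p = 4 * (p / 4) + 3 by omega, h4,
      show 3 * (4 * (p / 4) + 3) = 4 * (3 * (p / 4) + 2) + 1 by ring, h4, pow_one, add_comm]

end QuarticPeriod

/-- The argument is θ² for the quartic period θ. As θ^p = eθ, its (p-1)/2-th power is θ^(p-1) = e,
and Euler's criterion applies. -/
theorem quadraticChar_quarticPeriod_sq {m p : ℕ} [Fact m.Prime] [Fact p.Prime]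
    {χ : MulChar (ZMod m) GaussianInt} (hχ : orderOf χ = 4) (hp : p ≠ 2)
    (hm : (m : ZMod p) ≠ 0) (hpm : (p : ZMod m) ≠ 0) {e s : ℤ} (he : χ p = e)
    (he1 : e = 1 ∨ e = -1) (hs : χ (-1) = s) {r : ZMod p} (hr : r ^ 2 = m)
    (h0 : 2 * ((s : ZMod p) * m + (jacobiSum χ χ).re * r) ≠ 0) :
    quadraticChar (ZMod p) (2 * ((s : ZMod p) * m + (jacobiSum χ χ).re * r)) = e := by
  let F := AlgebraicClosure (ZMod p)
  have : CharP F p := charP_of_injective_algebraMap (algebraMap (ZMod p) F).injective p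
  have h2 : (2 : F) ≠ 0 := by
    rw [← map_ofNat (algebraMap (ZMod p) F) 2]
    simpa using two_ne_zero_zmod hp
  have hmF : (m : F) ≠ 0 := by
    rw [← map_natCast (algebraMap (ZMod p) F) m]
    exact (map_ne_zero _).2 hm
  obtain ⟨i, hi⟩ := IsAlgClosed.exists_pow_nat_eq (-1 : F) two_pos
  let f : GaussianInt →+* F := Zsqrtd.lift ⟨i, by rw [← sq, hi]; simp⟩
  have hφ := MulChar.orderOf_ringHomComp hχ h2 f
  have : NeZero (m : F) := ⟨hmF⟩
  obtain ⟨ζ, hζ⟩ := HasEnoughRootsOfUnity.exists_primitiveRoot F m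
  obtain ⟨ψ, hψ, hR⟩ := exists_primitive_gaussSum_eq hχ h2 hmF f
    (AddChar.zmodChar_primitive_of_primitive_root m hζ) (r := algebraMap (ZMod p) F r)
    (by rw [← map_pow, hr, map_natCast])
  obtain ⟨e1, e2, e3, -⟩ := gaussSum_sq_eq_of_orderOf_four hχ h2 hmF f hψ
  have hfrob := quarticPeriod_pow_char hφ hp hpm (e := (e : F))
    (by rw [MulChar.ringHomComp_apply, he, map_intCast])
    (by rcases he1 with rfl | rfl <;> simp) ψ
  have hJ : f (jacobiSum χ χ) + f (star (jacobiSum χ χ)) = 2 * ((jacobiSum χ χ).re : F) := by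
    rw [← map_add, show jacobiSum χ χ + star (jacobiSum χ χ) =
      ((2 * (jacobiSum χ χ).re : ℤ) : GaussianInt) by ext <;> simp; ring, map_intCast]
    push_cast
    rfl
  rw [hR] at e1 e2
  rw [hs, map_intCast] at e3
  set θ := gaussSum (χ.ringHomComp f) ψ + gaussSum (χ.ringHomComp f ^ 3) ψ with hθ
  set t : ZMod p := 2 * ((s : ZMod p) * m + (jacobiSum χ χ).re * r) with ht
  have hθ2 : θ ^ 2 = algebraMap (ZMod p) F t := by
    rw [ht]
    simp only [map_mul, map_add, map_intCast, map_natCast, map_ofNat]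
    rw [hθ]
    linear_combination e1 + e2 + 2 * e3 + algebraMap (ZMod p) F r * hJ
  have hθ0 : θ ≠ 0 := by
    intro h
    rw [h, zero_pow two_ne_zero] at hθ2
    exact h0 ((map_eq_zero _).1 hθ2.symm)
  have hodd := (Fact.out : p.Prime).eq_two_or_odd.resolve_left hp
  have hpow : t ^ (p / 2) = (e : ZMod p) := by
    apply (algebraMap (ZMod p) F).injective
    rw [map_pow, ← hθ2, map_intCast, ← pow_mul]
    apply mul_right_cancel₀ hθ0
    rw [← pow_succ, ← hfrob]
    congr 1
    omega
  have hq := quadraticChar_eq_pow_of_char_ne_two' (ringChar_zmod_ne_two hp) t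
  rw [ZMod.card, hpow] at hq
  have h11 : (1 : ZMod p) ≠ -1 := fun h => two_ne_zero_zmod hp (by linear_combination h)
  rcases he1 with rfl | rfl <;> rcases quadraticChar_dichotomy h0 with h | h <;>
    rw [h] at hq ⊢ <;> push_cast at hq
  · exact absurd hq.symm h11
  · exact absurd hq h11

/-! ### The basic triple and sign computations -/

theorem isQuarticTriple_of_sq_add_sq {m : ℕ} [hm : Fact m.Prime] {a b : ℤ}
    (hab : b ^ 2 + a ^ 2 = m) : IsQuarticTriple m m b a := by
  have hcop : IsCoprime b a := by
    rw [Int.isCoprime_iff_gcd_eq_one]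
    have hb := Int.gcd_dvd_left b a
    have ha := Int.gcd_dvd_right b a
    have hd : ((Int.gcd b a : ℤ)) * (Int.gcd b a) ∣ m := by
      rw [← hab, sq, sq]
      exact dvd_add (mul_dvd_mul hb hb) (mul_dvd_mul ha ha)
    have hd' : Int.gcd b a * Int.gcd b a ∣ m := by exact_mod_cast hd
    exact Nat.isUnit_iff.1 (hm.out.prime.squarefree _ hd')
  refine ⟨by rw [hab, sq], ?_, hcop, ?_⟩
  · rw [← hab, show b ^ 2 + a ^ 2 = a ^ 2 + b * b by ring]
    exact (hcop.symm.pow_left (m := 2)).add_mul_left_left b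
  · rw [← hab, show b ^ 2 + a ^ 2 = b ^ 2 + a * a by ring]
    exact ((hcop.pow_left (m := 2)).add_mul_left_left a).symm

theorem Int.sq_emod_eight_of_odd {n : ℤ} (h : Odd n) : n ^ 2 % 8 = 1 := by
  have : n % 8 = 1 ∨ n % 8 = 3 ∨ n % 8 = 5 ∨ n % 8 = 7 := by
    have := Int.odd_iff.1 h
    omega
  rcases this with h | h | h | h <;> simp [sq, Int.mul_emod, h]

theorem quadraticChar_neg_one_eq_pow {p : ℕ} [Fact p.Prime] (hp : p ≠ 2) :
    quadraticChar (ZMod p) (-1) = (-1) ^ ((p - 1) / 2) := by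
  have hodd := (Fact.out : p.Prime).eq_two_or_odd.resolve_left hp
  rw [quadraticChar_neg_one (ringChar_zmod_ne_two hp), ZMod.card, ZMod.χ₄_eq_neg_one_pow hodd]
  congr 1
  omega

theorem neg_one_pow_mul_div_eight {m p : ℕ} [Fact p.Prime] (hm : m % 4 = 1) (hp : p ≠ 2) :
    ((-1 : ℤ)) ^ ((p - 1) * (m - 1) / 8) = ((-1) ^ ((m - 1) / 4)) ^ ((p - 1) / 2) := by
  have hodd := (Fact.out : p.Prime).eq_two_or_odd.resolve_left hp
  rw [← pow_mul]
  congr 1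
  have h1 : p - 1 = 2 * ((p - 1) / 2) := by omega
  have h2 : m - 1 = 4 * ((m - 1) / 4) := by omega
  have h3 : (p - 1) * (m - 1) = 8 * ((m - 1) / 4 * ((p - 1) / 2)) := by
    conv_lhs => rw [h1, h2]
    ring
  rw [h3, Nat.mul_div_cancel_left _ (by norm_num)]

/-! ### Reciprocity for triples with B even, and the normalisation of signs -/

section Reciprocity

variable {m p : ℕ} [Fact m.Prime] [Fact p.Prime] {A B C : ℤ}

theorem surdSymbol_eq_of_pos_of_even (hm : m % 4 = 1) (hp : p ≠ 2) (hm0 : (m : ZMod p) ≠ 0)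
    (hsq : IsSquare (m : ZMod p)) (hp0 : (p : ZMod m) ≠ 0) (h : IsQuarticTriple m A B C)
    (hA : 0 < A) (hB : Even B) :
    surdSymbol m A B p = (-1) ^ ((p - 1) * (m - 1) / 8) * ratQuarticSymbol p m := by
  obtain ⟨χ, hχ⟩ := exists_quartic_mulChar hm
  have hpsq : IsSquare (p : ZMod m) :=
    (ZMod.exists_sq_eq_prime_iff_of_mod_four_eq_one hm hp).2 hsq
  have hp0' : ((p : ℤ) : ZMod m) ≠ 0 := by simpa using hp0
  have hpsq' : IsSquare ((p : ℤ) : ZMod m) := by simpa using hpsq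
  obtain ⟨ha, hb⟩ := odd_re_jacobiSum hm hχ
  have hN := norm_jacobiSum hχ
  have hs := MulChar.apply_neg_one_of_orderOf_four hm hχ
  have key : ∀ r : ZMod p, r ^ 2 = m → _ → _ := fun r hr h0 =>
    quadraticChar_quarticPeriod_sq hχ hp hm0 hp0 (e := ratQuarticSymbol p m)
      (s := (-1) ^ ((m - 1) / 4))
      (by rw [ratQuarticSymbol_eq_mulChar hχ hp0' hpsq', Int.cast_natCast])
      (ratQuarticSymbol_eq_or _ hp0' hpsq') (by rw [hs]; push_cast; rfl) hr h0
  rw [Zsqrtd.norm_def] at hN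
  generalize (jacobiSum χ χ).re = a at *
  generalize (jacobiSum χ χ).im = b at *
  have hab : b ^ 2 + a ^ 2 = m := by linear_combination hN
  have T := isQuarticTriple_of_sq_add_sq hab
  rw [surdSymbol_eq_of_even h hA hB hab ha hb T hp hm0 hsq, neg_one_pow_mul_div_eight hm hp]
  have h2 := two_ne_zero_zmod hp
  have hq2 : quadraticChar (ZMod p) 2 ^ 2 = 1 := quadraticChar_sq_one h2
  -- With A' = χ(-1)m, the period gives the symbol of 2(A' + a√m). Exchanging a and b introduces a
  -- second factor (2/p), which cancels the first.
  have aux : ∀ A' : ℤ, IsQuarticTriple m A' b a →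
      ((A' : ℤ) : ZMod p) = (((-1) ^ ((m - 1) / 4) : ℤ) : ZMod p) * m →
      surdSymbol m A' b p = ratQuarticSymbol p m := by
    intro A' T' hA'
    obtain ⟨r, hr, h0, e⟩ := exists_quadraticChar_eq_surdSymbol T'.swap hp hm0 hsq
    have k := key r hr (by rw [← hA']; exact mul_ne_zero h2 h0)
    rw [← hA', map_mul, e, surdSymbol_eq_two_mul_swap T'.swap hp hm0 hsq, ← mul_assoc, ← sq, hq2,
      one_mul] at k
    exact k
  rcases neg_one_pow_eq_or ℤ ((m - 1) / 4) with hs1 | hs1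
  · rw [hs1] at aux ⊢
    rw [one_pow, one_mul]
    exact aux m T (by push_cast; ring)
  · rw [hs1] at aux ⊢
    -- When χ(-1) = -1, passing from -m to m costs (-1/p) = (-1)^((p-1)/2), exactly the sign in the
    -- statement.
    rw [← aux (-m) T.neg_left (by push_cast; ring), surdSymbol_neg_left T hp hm0 hsq,
      quadraticChar_neg_one_eq_pow hp, ← mul_assoc, ← sq, ← pow_mul, mul_comm _ 2, pow_mul]
    simp

theorem ratQuarticSymbol_primeStar (hm : m % 4 = 1) (hp : p ≠ 2) (hp0 : (p : ZMod m) ≠ 0)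
    (hpsq : IsSquare (p : ZMod m)) :
    ratQuarticSymbol (primeStar p) m = (-1) ^ ((p - 1) * (m - 1) / 8) * ratQuarticSymbol p m := by
  obtain ⟨χ, hχ⟩ := exists_quartic_mulChar hm
  have hp0' : ((p : ℤ) : ZMod m) ≠ 0 := by simpa using hp0
  have hpsq' : IsSquare ((p : ℤ) : ZMod m) := by simpa using hpsq
  have hneg : IsSquare (-1 : ZMod m) := ZMod.exists_sq_eq_neg_one_iff.2 (by omega)
  have hst : ((primeStar p : ℤ) : ZMod m) = (-1) ^ ((p - 1) / 2) * (p : ℤ) := by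
    rw [primeStar]
    push_cast
    rfl
  have h0 : ((primeStar p : ℤ) : ZMod m) ≠ 0 := by
    rw [hst]
    exact mul_ne_zero (pow_ne_zero _ (by simp)) hp0'
  have hs : IsSquare ((primeStar p : ℤ) : ZMod m) := by
    rw [hst]
    exact (hneg.pow _).mul hpsq'
  have h := ratQuarticSymbol_eq_mulChar hχ h0 hs
  rw [hst, map_mul, map_pow, MulChar.apply_neg_one_of_orderOf_four hm hχ,
    ← ratQuarticSymbol_eq_mulChar hχ hp0' hpsq'] at h
  rw [neg_one_pow_mul_div_eight hm hp]
  exact_mod_cast h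

/-- In a triple with `B` even, `|A| ≡ 1 mod 4`, and `4 ∣ B` if and only if `m ≡ 1 mod 8`. -/
theorem IsQuarticTriple.mod_four (hm : m % 4 = 1) (h : IsQuarticTriple m A B C) (hB : Even B) :
    |A| % 4 = 1 ∧ (B % 4 = 0 ↔ m % 8 = 1) := by
  have hmp : Prime (m : ℤ) := Nat.prime_iff_prime_int.1 (Fact.out : m.Prime)
  have hAodd := h.odd_of_even hB
  have hCodd : Odd C := by
    rw [← Int.not_even_iff_odd]
    intro hC
    exact absurd (h.2.2.1.isUnit_of_dvd' hB.two_dvd hC.two_dvd) (by decide)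
  obtain ⟨χ, hχ⟩ := exists_quartic_mulChar hm
  obtain ⟨ha, hb⟩ := odd_re_jacobiSum hm hχ
  have hN := norm_jacobiSum hχ
  rw [Zsqrtd.norm_def] at hN
  obtain ⟨-, x, y, -, hA, -⟩ := h.abs_left.exists_param (abs_pos.2 h.left_ne_zero) hB
    (a := (jacobiSum χ χ).re) (b := (jacobiSum χ χ).im) (by linear_combination hN) ha hb
  have hxy : Odd (x ^ 2 + y ^ 2) := by
    have : Odd |A| := by rcases abs_choice A with e | e <;> rw [e]; exacts [hAodd, hAodd.neg]
    rw [hA] at this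
    exact (Int.odd_mul.1 this).2
  have hmz : (m : ℤ) % 4 = 1 := by omega
  constructor
  -- |A| is m times an odd sum of two squares, and both factors are 1 modulo 4.
  · have h4 : (x ^ 2 + y ^ 2) % 4 = 1 := by
      have hsq4 : ∀ n : ℤ, n ^ 2 % 4 = 0 ∨ n ^ 2 % 4 = 1 := fun n => by
        have : n % 4 = 0 ∨ n % 4 = 1 ∨ n % 4 = 2 ∨ n % 4 = 3 := by omega
        rcases this with h | h | h | h <;> simp [sq, Int.mul_emod, h]
      have hx := hsq4 x
      have hy := hsq4 y
      have := Int.odd_iff.1 hxy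
      omega
    rw [hA, Int.mul_emod, hmz, h4]
    rfl
  -- Odd squares are 1 modulo 8, so B² + C² = m(x² + y²)² reads B² + 1 ≡ m modulo 8.
  · have hk := Int.sq_emod_eight_of_odd hxy
    have hC := Int.sq_emod_eight_of_odd hCodd
    have hBC : B ^ 2 + C ^ 2 = m * (x ^ 2 + y ^ 2) ^ 2 := by
      apply mul_left_cancel₀ hmp.ne_zero
      rw [← h.1, ← sq_abs, hA]
      ring
    have hmod : (B ^ 2 + C ^ 2) % 8 = m % 8 := by
      rw [hBC, Int.mul_emod, hk]
      omega
    have hB8 : B % 4 = 0 ∧ B ^ 2 % 8 = 0 ∨ B % 4 = 2 ∧ B ^ 2 % 8 = 4 := by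
      have := Int.even_iff.1 hB
      have : B % 8 = 0 ∨ B % 8 = 2 ∨ B % 8 = 4 ∨ B % 8 = 6 := by omega
      rcases this with h | h | h | h
      · exact Or.inl ⟨by omega, by simp [sq, Int.mul_emod, h]⟩
      · exact Or.inr ⟨by omega, by simp [sq, Int.mul_emod, h]⟩
      · exact Or.inl ⟨by omega, by simp [sq, Int.mul_emod, h]⟩
      · exact Or.inr ⟨by omega, by simp [sq, Int.mul_emod, h]⟩
    omega

/-- Since |A| ≡ 1 modulo 4, the normalisation forces 4 ∣ B, so m ≡ 1 modulo 8, when A > 0, and B ≡ 2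
modulo 4, so m ≡ 5 modulo 8, when A < 0. The sign of A thus matches the parity of (m-1)/4, and a
negative A contributes (-1/p). -/
theorem surdSymbol_eq_abs_of_normalised (hm : m % 4 = 1) (hp : p ≠ 2) (hm0 : (m : ZMod p) ≠ 0)
    (hsq : IsSquare (m : ZMod p)) (h : IsQuarticTriple m A B C) (hB : Even B)
    (hAB : A + B ≡ 1 [ZMOD 4]) :
    surdSymbol m A B p = (-1) ^ ((p - 1) * (m - 1) / 8) * surdSymbol m |A| |B| p := by
  rw [surdSymbol_abs_mid h.abs_left hp hm0 hsq, neg_one_pow_mul_div_eight hm hp]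
  obtain ⟨hA4, hB4⟩ := h.mod_four hm hB
  have hB2 := Int.even_iff.1 hB
  unfold Int.ModEq at hAB
  rcases abs_cases A with ⟨e, -⟩ | ⟨e, -⟩ <;> rw [e] at hA4 ⊢
  · have h8 : m % 8 = 1 := hB4.1 (by omega)
    rw [Even.neg_one_pow (Nat.even_iff.2 (by omega)), one_pow, one_mul]
  · have h8 : m % 8 ≠ 1 := fun h8 => by
      have := hB4.2 h8
      omega
    rw [Odd.neg_one_pow (Nat.odd_iff.2 (by omega)), surdSymbol_neg_left h hp hm0 hsq,
      quadraticChar_neg_one_eq_pow hp, ← mul_assoc, ← sq, ← pow_mul, mul_comm _ 2, pow_mul]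
    simp

end Reciprocity

/-! ### The reciprocity theorem -/

theorem mainTheorem2 (m p : ℕ) [Fact m.Prime] [Fact p.Prime] (hm : m % 4 = 1) (hp : p ≠ 2)
    (hmp : legendreSym p (m : ℤ) = 1) :
    -- the symbol `((A + B√m)/p)` does not depend on the choice of the square root of `m` mod `p`
    (∀ A B C : ℤ, IsQuarticTriple m A B C →
      (∃ r : ZMod p, r ^ 2 = (m : ZMod p) ∧ (A : ZMod p) + (B : ZMod p) * r ≠ 0) ∧
      ∀ r : ZMod p, r ^ 2 = (m : ZMod p) → (A : ZMod p) + (B : ZMod p) * r ≠ 0 →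
        quadraticChar (ZMod p) ((A : ZMod p) + (B : ZMod p) * r) = surdSymbol m A B p) ∧
    -- the form with `B` odd and `C` even
    (∀ A B C : ℤ, IsQuarticTriple m A B C → 0 < A → 0 < B → 0 < C → Odd B → Even C →
      surdSymbol m A B p =
        (-1) ^ ((p - 1) * (m - 1) / 8) * legendreSym p 2 * ratQuarticSymbol p m) ∧
    -- the forms with `B` even
    (∀ A B C : ℤ, IsQuarticTriple m A B C → 0 < A → 0 < B → Even B →
      surdSymbol m A B p = (-1) ^ ((p - 1) * (m - 1) / 8) * ratQuarticSymbol p m ∧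
      surdSymbol m A B p = ratQuarticSymbol (primeStar p) m) ∧
    -- the identity behind the equivalence, and the relation between symbols that it gives
    (∀ A B C : ℤ, IsQuarticTriple m A B C →
      2 * ((A : ℝ) + B * √(m : ℝ)) * ((A : ℝ) + C * √(m : ℝ)) =
        ((A : ℝ) + B * √(m : ℝ) + C * √(m : ℝ)) ^ 2 ∧
      surdSymbol m A B p = legendreSym p 2 * surdSymbol m A C p) ∧
    -- equivalence of these forms with the form normalised by `2 ∣ B`, `A + B ≡ 1 mod 4`
    (∀ A B C : ℤ, IsQuarticTriple m A B C → Even B → A + B ≡ 1 [ZMOD 4] →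
      surdSymbol m A B p = (-1) ^ ((p - 1) * (m - 1) / 8) * surdSymbol m |A| |B| p ∧
      List.TFAE [
        surdSymbol m A B p = ratQuarticSymbol p m,
        surdSymbol m |A| |C| p =
          (-1) ^ ((p - 1) * (m - 1) / 8) * legendreSym p 2 * ratQuarticSymbol p m,
        surdSymbol m |A| |B| p = (-1) ^ ((p - 1) * (m - 1) / 8) * ratQuarticSymbol p m,
        surdSymbol m |A| |B| p = ratQuarticSymbol (primeStar p) m]) := by
  have hm0 : (m : ZMod p) ≠ 0 := by
    intro h
    have h0 : legendreSym p (m : ℤ) = 0 := by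
      rw [legendreSym.eq_zero_iff]
      exact_mod_cast h
    omega
  have hsq : IsSquare (m : ZMod p) := by
    have := (legendreSym.eq_one_iff p (a := (m : ℤ)) (by exact_mod_cast hm0)).1 hmp
    exact_mod_cast this
  have hpm : p ≠ m := by
    rintro rfl
    exact hm0 (ZMod.natCast_self p)
  have hp0 : (p : ZMod m) ≠ 0 := ZMod.prime_ne_zero m p hpm.symm
  have hpsq : IsSquare (p : ZMod m) :=
    (ZMod.exists_sq_eq_prime_iff_of_mod_four_eq_one hm hp).2 hsq
  have hleg : legendreSym p 2 = quadraticChar (ZMod p) 2 := by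
    rw [legendreSym]
    norm_num
  have heven : ∀ A B C : ℤ, IsQuarticTriple m A B C → 0 < A → Even B →
      surdSymbol m A B p = (-1) ^ ((p - 1) * (m - 1) / 8) * ratQuarticSymbol p m :=
    fun A B C h hA hB => surdSymbol_eq_of_pos_of_even hm hp hm0 hsq hp0 h hA hB
  have hodd : ∀ A B C : ℤ, IsQuarticTriple m A B C → 0 < A → Even C →
      surdSymbol m A B p =
        (-1) ^ ((p - 1) * (m - 1) / 8) * legendreSym p 2 * ratQuarticSymbol p m := by
    intro A B C h hA hC
    rw [surdSymbol_eq_two_mul_swap h hp hm0 hsq, heven A C B h.swap hA hC, hleg]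
    ring
  have hstar := ratQuarticSymbol_primeStar hm hp hp0 hpsq
  refine ⟨fun A B C h => ⟨?_, fun r hr h0 => quadraticChar_eq_surdSymbol h hr h0⟩,
    fun A B C h hA _ _ _ hC => hodd A B C h hA hC,
    fun A B C h hA _ hB => ⟨heven A B C h hA hB, by rw [hstar, heven A B C h hA hB]⟩,
    fun A B C h => ⟨?_, by rw [hleg, surdSymbol_eq_two_mul_swap h hp hm0 hsq]⟩,
    fun A B C h hB hAB => ?_⟩
  · obtain ⟨r, hr, h0, -⟩ := exists_quadraticChar_eq_surdSymbol h hp hm0 hsq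
    exact ⟨r, hr, h0⟩
  · have h1 : (A : ℝ) ^ 2 = m * ((B : ℝ) ^ 2 + (C : ℝ) ^ 2) := by exact_mod_cast h.1
    have h2 : √(m : ℝ) ^ 2 = m := Real.sq_sqrt (Nat.cast_nonneg m)
    linear_combination h1 - ((B : ℝ) ^ 2 + (C : ℝ) ^ 2) * h2
  · have hn := surdSymbol_eq_abs_of_normalised hm hp hm0 hsq h hB hAB
    have hpos : 0 < |A| := abs_pos.2 h.left_ne_zero
    have hc := heven _ _ _ h.abs_left.abs_mid hpos (even_abs.2 hB)
    have hb := hodd _ _ _ h.abs_left.swap.abs_mid hpos hB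
    -- The four formulas are equivalent because each of them holds.
    refine ⟨hn, List.tfae_of_forall True _ ?_⟩
    simp only [List.mem_cons, List.not_mem_nil, or_false, forall_eq_or_imp, forall_eq, iff_true]
    refine ⟨?_, hb, hc, by rw [hstar, hc]⟩
    rw [hn, hc, ← mul_assoc, ← sq, ← pow_mul, mul_comm _ 2, pow_mul]
    simp
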